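/- **Theorem (co-recursive Laguerre moments).** For a permutation $\sigma$ of $[n]$ let $\mathrm{rlm}(\sigma)$ be the number of its right-to-left minima, i.e. of indices $i$ with $\sigma(i)<\sigma(j)$ for all $j>i$, and let $$D_n(x)=\sum_{\sigma} x^{\mathrm{rlm}(\sigma)},$$ the sum being over all derangements $\sigma$ of $[n]$ (so $D_0=1$, $D_1=0$). The monic Laguerre polynomials $L_n^{(\alpha)}(x)$ are defined by $$\sum_{n\ge 0}L_n^{(\alpha)}(x)\frac{t^n}{n!}=\frac{1}{(1+t)^{1+\alpha}}\exp\Bigl(\frac{xt}{1+t}\Bigr),$$ and the associated Laguerre polynomials $L_n^{(\alpha)}(x;c)$ by $L_{-1}^{(\alpha)}(x;c)=0$, $L_0^{(\alpha)}(x;c)=1$ and $$L_{n+1}^{(\alpha)}(x;c)=\bigl(x-(\alpha+2n+2c+1)\bigr)L_n^{(\alpha)}(x;c)-(n+c)(n+c+\alpha)L_{n-1}^{(\alpha)}(x;c)\qquad(n\ge 0).$$ Let $a$ be a real number and put, for $n\ge 0$, $$P_n(x)=L_n^{(a-1)}(x+1)+(a-1)\,L_{n-1}^{(a-1)}(x+1;1).$$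 1. $(P_n)$ is the co-recursive sequence, with parameter $c=1-a$, of the shifted Laguerre polynomials $p_n(x)=L_n^{(a-1)}(x+1)$. That is, $p_0=P_0=1$, $p_1(x)=x-(a-1)$, $P_1=p_1-(1-a)$, and both $y_n=p_n$ and $y_n=P_n$ satisfy $$y_{n+1}=\bigl(x-(a+2n-1)\bigr)y_n-n(n+a-1)\,y_{n-1}\qquad(n\ge 1).$$ 2. Each $P_n$ is monic of degree $n$, and $(D_n(a))_{n\ge0}$ is the moment sequence of $(P_n)$: for a real sequence $(\mu_n)_{n\ge 0}$ let $\mathcal L_\mu$ be the linear functional on $\mathbb R[x]$ with $\mathcal L_\mu(x^n)=\mu_n$; then $$\mu_0=1\ \text{ and }\ \mathcal L_\mu(P_mP_n)=0\ \text{ for all } m\ne n\quad\Longleftrightarrow\quad \mu_n=D_n(a)\ \text{ for all } n\ge 0.$$ 3. Let $\mathcal L$ be the functional with $\mathcal L(x^n)=D_n(a)$. If $a\notin\{0,-1,-2,\dots\}$, then $(P_n)$ is an orthogonal polynomial sequence for $\mathcal L$, i.e. $\deg P_n=n$, $\mathcal L(P_mP_n)=0$ for $m\neq n$, and $\mathcal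 L(P_n^2)\ne 0$ for all $n$. If $a>0$, then moreover $\mathcal L(P_n^2)>0$ for all $n$. -/

import Mathlib

noncomputable section

open Polynomial

/-- The number of right-to-left minima of a permutation: positions `i` such that
`σ i < σ j` for all `j > i` (so the last position always counts). -/
def rlm {n : ℕ} (σ : Equiv.Perm (Fin n)) : ℕ :=
  {i : Fin n | ∀ j, i < j → σ i < σ j}.ncard

open Classical in
/-- `D_n(x) = ∑ x ^ rlm σ`, the sum being over all derangements `σ` of an `n`-element chain. -/
def derangementPoly (n : ℕ) : ℝ[X] :=
  ∑ σ : Equiv.Perm (Fin n) with σ ∈ derangements (Fin n), X ^ rlm σ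

/-- The power series `(1+t)^{-(1+α)} exp(x t / (1+t))` in `t`, with coefficients in `ℝ[x]`. -/
def laguerreGF (α : ℝ) : PowerSeries ℝ[X] :=
  PowerSeries.binomialSeries ℝ[X] (-(1 + α)) *
    (PowerSeries.exp ℝ[X]).subst
      (PowerSeries.C (X : ℝ[X]) * PowerSeries.X * PowerSeries.binomialSeries ℝ[X] (-1 : ℝ))

/-- The monic Laguerre polynomial `L_n^{(α)}(x)`, defined by
`∑ L_n^{(α)}(x) t^n / n! = (1+t)^{-(1+α)} exp(x t / (1+t))`. -/
def laguerre (α : ℝ) (n : ℕ) : ℝ[X] :=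
  (n.factorial : ℝ[X]) * PowerSeries.coeff n (laguerreGF α)

/-- The monic associated Laguerre polynomial `L_n^{(α)}(x; c)`. -/
def assocLaguerre (α c : ℝ) : ℕ → ℝ[X]
  | 0 => 1
  | 1 => X - C (α + 2 * c + 1)
  | n + 2 => (X - C (α + 2 * ((n : ℝ) + 1) + 2 * c + 1)) * assocLaguerre α c (n + 1)
      - C (((n : ℝ) + 1 + c) * ((n : ℝ) + 1 + c + α)) * assocLaguerre α c n

/-- `P_n(x) = L_n^{(a-1)}(x+1) + (a-1) L_{n-1}^{(a-1)}(x+1; 1)`, where the associated Laguerre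
polynomial of index `-1` is zero. -/
def laguerreP (a : ℝ) : ℕ → ℝ[X]
  | 0 => (laguerre (a - 1) 0).comp (X + 1)
  | n + 1 => (laguerre (a - 1) (n + 1)).comp (X + 1)
      + C (a - 1) * (assocLaguerre (a - 1) 1 n).comp (X + 1)

/-- `P_{n+1}(x) = (x - b_n) P_n(x) - lam_n P_{n-1}(x)` for all `n ≥ 1`. -/
def SatisfiesRecurrence (b lam : ℕ → ℝ) (P : ℕ → ℝ[X]) : Prop :=
  ∀ n : ℕ, P (n + 2) = (X - C (b (n + 1))) * P (n + 1) - C (lam (n + 1)) * P n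

/-- `P` is the sequence given by `P_0 = 1`, `P_1 = x - b_0` and the three-term recurrence with
coefficients `b`, `lam`, and `Q` is its co-recursive sequence with parameter `c`: it obeys the same
recurrence, with `Q_0 = 1` and `Q_1 = P_1 - c`. -/
structure IsCoRecursive (b lam : ℕ → ℝ) (c : ℝ) (P Q : ℕ → ℝ[X]) : Prop where
  base_zero : P 0 = 1
  base_one : P 1 = X - C (b 0)
  base_rec : SatisfiesRecurrence b lam P
  zero : Q 0 = 1
  one : Q 1 = P 1 - C c
  recurrence : SatisfiesRecurrence b lam Q

/-- The linear functional on polynomials with `x ^ n ↦ μ n`. -/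
def momentFunctional (μ : ℕ → ℝ) : ℝ[X] →ₗ[ℝ] ℝ :=
  Polynomial.lsum fun n => LinearMap.mulRight ℝ (μ n)

theorem momentFunctional_X_pow (μ : ℕ → ℝ) (n : ℕ) : momentFunctional μ (X ^ n) = μ n := by
  simp [momentFunctional, Polynomial.lsum_apply, ← Polynomial.monomial_one_right_eq_X_pow,
    Polynomial.sum_monomial_index]

/-- `P` is an orthogonal polynomial sequence for the functional `ℒ`. -/
structure IsOrthogonalSeq (ℒ : ℝ[X] →ₗ[ℝ] ℝ) (P : ℕ → ℝ[X]) : Prop where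
  degree_eq : ∀ n : ℕ, (P n).degree = n
  orthogonal : ∀ m n : ℕ, m ≠ n → ℒ (P m * P n) = 0
  norm_ne_zero : ∀ n : ℕ, ℒ (P n * P n) ≠ 0

end

/-! ### Laguerre polynomials: from generating function to three-term recurrence. -/

section Laguerre

open Polynomial

/-! The bridge is `historySum a n h`, a weighted count satisfying H(n+1,h) = (a+h-1) H(n,h-1) + b_h
H(n,h) + (h+1) H(n,h+1), with b_h = a+2h-1 for h > 0 and b_0 = 0 (`historySum_succ`). After scaling
by h! these are the recurrence coefficients of P_h, the co-recursive shift being exactly what makes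
b_0 zero. Deleting the largest value of a derangement again and again gives D_n(a) = H(n,0), so
induction on h yields L(x^n P_h) = h! H(n,h) (`derangementFunctional_X_pow_mul`). Since H(n,h) = 0
for n < h, orthogonality follows; H(n,n) = a(a+1)...(a+n-1) gives the norms. Uniqueness holds
because orthogonality to P_0 = 1 fixes the functional on the basis (P_n). -/

theorem powerSeries_derivative_mul {R : Type*} [CommRing R] (f g : PowerSeries R) :
    PowerSeries.derivative R (f * g) =
      f * PowerSeries.derivative R g + g * PowerSeries.derivative R f :=
  Derivation.leibniz _ f g

theorem binomialSeries_derivative (r : ℝ) :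
    (1 + PowerSeries.X) *
        PowerSeries.derivative ℝ[X] (PowerSeries.binomialSeries ℝ[X] r) =
      PowerSeries.C (C r) * PowerSeries.binomialSeries ℝ[X] r := by
  have key : ∀ n : ℕ, Ring.choose r (n + 1) * ((n : ℝ) + 1) = (r - n) * Ring.choose r n := by
    intro n
    have h := Ring.choose_smul_choose r (Nat.le_succ n)
    simp only [Nat.succ_eq_add_one, Nat.choose_succ_self_right, add_tsub_cancel_left,
      Ring.choose_one_right, nsmul_eq_mul] at h
    push_cast at h
    linarith
  ext1 n
  rw [add_mul, one_mul, map_add, PowerSeries.coeff_C_mul, PowerSeries.coeff_derivative]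
  cases n with
  | zero =>
    have h := key 0
    simp only [zero_add, Nat.cast_zero, sub_zero, mul_one] at h
    simp [PowerSeries.coeff_zero_X_mul, h, Polynomial.smul_eq_C_mul]
  | succ n =>
    have h := key (n + 1)
    rw [PowerSeries.coeff_succ_X_mul, PowerSeries.coeff_derivative]
    simp only [PowerSeries.binomialSeries_coeff, Polynomial.smul_eq_C_mul, mul_one]
    have e : ((n + 1 : ℕ) : ℝ[X]) = C ((n : ℝ) + 1) := by simp
    have e' : (n : ℝ[X]) = C (n : ℝ) := by simp
    rw [e, e', ← C_1, ← C_add, ← C_add, ← C_mul, ← C_mul, ← C_mul, ← C_add]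
    congr 1
    push_cast at h
    linarith

theorem binomialSeries_neg_one_mul :
    PowerSeries.binomialSeries ℝ[X] (-1 : ℝ) * (1 + PowerSeries.X) = 1 := by
  have h := PowerSeries.binomialSeries_add (A := ℝ[X]) (-1 : ℝ) 1
  have h1 := PowerSeries.binomialSeries_nat (R := ℝ) (A := ℝ[X]) 1
  simp only [Nat.cast_one, pow_one] at h1
  rw [← h1, ← h]
  simp

theorem hasSubst_laguerre :
    PowerSeries.HasSubst (PowerSeries.C (X : ℝ[X]) * PowerSeries.X *
      PowerSeries.binomialSeries ℝ[X] (-1 : ℝ)) :=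
  PowerSeries.HasSubst.of_constantCoeff_zero' (by simp)

/-- Logarithmic differentiation, with denominators cleared by (1+t)^2; comparing coefficients of
t^(n+1) then gives the Laguerre recurrence. -/
theorem laguerreGF_derivative (α : ℝ) :
    (1 + PowerSeries.X) ^ 2 * PowerSeries.derivative ℝ[X] (laguerreGF α) =
      (PowerSeries.C (X : ℝ[X]) - PowerSeries.C (C (1 + α)) * (1 + PowerSeries.X)) *
        laguerreGF α := by
  have h1 := binomialSeries_derivative (-(1 + α))
  have h2 := binomialSeries_derivative (-1)
  have h3 := binomialSeries_neg_one_mul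
  unfold laguerreGF
  rw [powerSeries_derivative_mul, PowerSeries.derivative_subst hasSubst_laguerre,
    PowerSeries.derivative_exp, powerSeries_derivative_mul, powerSeries_derivative_mul,
    PowerSeries.derivative_C, PowerSeries.derivative_X]
  simp only [mul_zero, add_zero, mul_one, map_neg, map_one] at *
  -- With every series replaced by a variable, only an identity in a commutative ring remains.
  generalize PowerSeries.subst (PowerSeries.C (X : ℝ[X]) * PowerSeries.X *
    PowerSeries.binomialSeries ℝ[X] (-1 : ℝ)) (PowerSeries.exp ℝ[X]) = E at *
  generalize PowerSeries.derivative ℝ[X] (PowerSeries.binomialSeries ℝ[X] (-(1 + α))) = B' at *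
  generalize PowerSeries.derivative ℝ[X] (PowerSeries.binomialSeries ℝ[X] (-1 : ℝ)) = N' at *
  generalize PowerSeries.binomialSeries ℝ[X] (-(1 + α)) = B at *
  generalize PowerSeries.binomialSeries ℝ[X] (-1 : ℝ) = N at *
  generalize PowerSeries.C (X : ℝ[X]) = x at *
  generalize PowerSeries.C (C (1 + α)) = c at *
  generalize (PowerSeries.X : PowerSeries ℝ[X]) = t at *
  linear_combination (1 + t) * E * h1 + B * E * x * t * (1 + t) * h2 + B * E * x * h3

theorem constantCoeff_laguerreGF (α : ℝ) :
    PowerSeries.constantCoeff (laguerreGF α) = 1 := by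
  have h : ∀ d : ℕ, d ≠ 0 → PowerSeries.coeff d (PowerSeries.exp ℝ[X]) •
      PowerSeries.constantCoeff ((PowerSeries.C (X : ℝ[X]) * PowerSeries.X *
        PowerSeries.binomialSeries ℝ[X] (-1 : ℝ)) ^ d) = 0 := by
    intro d hd
    simp [hd]
  rw [laguerreGF, map_mul, PowerSeries.binomialSeries_constantCoeff, one_mul,
    ← PowerSeries.coeff_zero_eq_constantCoeff_apply,
    PowerSeries.coeff_subst' hasSubst_laguerre]
  simp only [PowerSeries.coeff_zero_eq_constantCoeff_apply]
  rw [finsum_eq_single _ 0 h]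
  simp

theorem laguerre_zero (α : ℝ) : laguerre α 0 = 1 := by
  simp [laguerre, constantCoeff_laguerreGF]

theorem laguerre_one (α : ℝ) : laguerre α 1 = X - C (1 + α) := by
  have h := congrArg (PowerSeries.coeff 0) (laguerreGF_derivative α)
  have e : PowerSeries.constantCoeff (PowerSeries.derivative ℝ[X] (laguerreGF α)) =
      PowerSeries.coeff 1 (laguerreGF α) := by
    rw [← PowerSeries.coeff_zero_eq_constantCoeff_apply, PowerSeries.coeff_derivative]
    simp
  simp only [PowerSeries.coeff_zero_eq_constantCoeff_apply, map_mul, map_pow, map_add, map_sub,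
    map_one, PowerSeries.constantCoeff_X, PowerSeries.constantCoeff_C, e,
    constantCoeff_laguerreGF] at h
  simp only [laguerre, Nat.factorial_one, Nat.cast_one, one_mul, C_add, C_1]
  linear_combination h

theorem laguerre_succ_succ (α : ℝ) (n : ℕ) :
    laguerre α (n + 2) = (X - C (α + 2 * (n + 1) + 1)) * laguerre α (n + 1) -
      C ((n + 1) * (n + 1 + α)) * laguerre α n := by
  have h := congrArg (PowerSeries.coeff (n + 1)) (laguerreGF_derivative α)
  have e1 (D : PowerSeries ℝ[X]) : (1 + PowerSeries.X) ^ 2 * D =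
    D + PowerSeries.X * (D + D + PowerSeries.X * D) := by ring
  have e2 (F x c : PowerSeries ℝ[X]) : (x - c * (1 + PowerSeries.X)) * F =
    x * F - (c * F + c * (PowerSeries.X * F)) := by ring
  have e3 : PowerSeries.coeff n (PowerSeries.X *
      PowerSeries.derivative ℝ[X] (laguerreGF α)) =
      n * PowerSeries.coeff n (laguerreGF α) := by
    cases n with
    | zero => simp
    | succ n =>
      rw [PowerSeries.coeff_succ_X_mul, PowerSeries.coeff_derivative]
      push_cast
      ring
  rw [e1, e2, map_add, PowerSeries.coeff_succ_X_mul, map_add, map_add, map_sub, map_add,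
    PowerSeries.coeff_C_mul, PowerSeries.coeff_C_mul, PowerSeries.coeff_C_mul,
    PowerSeries.coeff_succ_X_mul, e3] at h
  simp only [PowerSeries.coeff_derivative] at h
  simp only [laguerre, Nat.factorial_succ]
  simp only [C_add, C_mul, C_1, map_natCast, C_ofNat]
  simp only [C_add, C_1] at h
  push_cast at h ⊢
  linear_combination ((n : ℝ[X]) + 1) * (n.factorial : ℝ[X]) * h

theorem laguerre_comp_recurrence (a : ℝ) :
    SatisfiesRecurrence (fun n : ℕ => a + 2 * n - 1) (fun n : ℕ => n * (n + a - 1))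
      (fun n => (laguerre (a - 1) n).comp (X + 1)) := by
  intro n
  simp only [laguerre_succ_succ, sub_comp, mul_comp, X_comp, C_comp]
  simp only [C_add, C_mul, C_sub, C_1, map_natCast, C_ofNat, Nat.cast_add, Nat.cast_one]
  ring

/-- Taking c = 1 shifts the recurrence coefficients by one index, so the associated term obeys the
same recurrence as the Laguerre term. -/
theorem laguerreP_recurrence (a : ℝ) :
    SatisfiesRecurrence (fun n : ℕ => a + 2 * n - 1) (fun n : ℕ => n * (n + a - 1))
      (laguerreP a) := by
  intro n
  have h := laguerre_comp_recurrence a n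
  cases n with
  | zero =>
    simp only [laguerreP, assocLaguerre, sub_comp, X_comp, C_comp, one_comp, h]
    simp only [C_add, C_mul, C_sub, C_1, map_natCast, C_ofNat, Nat.cast_add, Nat.cast_one]
    simp
    ring
  | succ n =>
    simp only [laguerreP, h, assocLaguerre, sub_comp, mul_comp, X_comp, C_comp]
    simp only [C_add, C_mul, C_sub, C_1, map_natCast, C_ofNat, Nat.cast_add, Nat.cast_one]
    ring

theorem laguerreP_zero (a : ℝ) : laguerreP a 0 = 1 := by
  simp [laguerreP, laguerre_zero]

theorem laguerreP_one (a : ℝ) : laguerreP a 1 = X := by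
  simp [laguerreP, laguerre_one, assocLaguerre]

theorem laguerreP_isCoRecursive (a : ℝ) :
    IsCoRecursive (fun n : ℕ => a + 2 * n - 1) (fun n : ℕ => n * (n + a - 1)) (1 - a)
      (fun n => (laguerre (a - 1) n).comp (X + 1)) (laguerreP a) where
  base_zero := by simp [laguerre_zero]
  base_one := by
    simp [laguerre_one]
    ring
  base_rec := laguerre_comp_recurrence a
  zero := laguerreP_zero a
  one := by
    simp [laguerreP_one, laguerre_one]
  recurrence := laguerreP_recurrence a

theorem SatisfiesRecurrence.monic_and_natDegree {b lam : ℕ → ℝ} {P : ℕ → ℝ[X]}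
    (h : SatisfiesRecurrence b lam P) (h0 : P 0 = 1) {c : ℝ} (h1 : P 1 = X - C c) (n : ℕ) :
    (P n).Monic ∧ (P n).natDegree = n := by
  induction n using Nat.twoStepInduction with
  | zero => simp [h0]
  | one => simp [h1, monic_X_sub_C]
  | more n ih0 ih1 =>
    have hm : ((X - C (b (n + 1))) * P (n + 1)).Monic := (monic_X_sub_C _).mul ih1.1
    have hd : ((X - C (b (n + 1))) * P (n + 1)).natDegree = n + 2 := by
      rw [(monic_X_sub_C _).natDegree_mul ih1.1, natDegree_X_sub_C, ih1.2]
      omega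
    have hlt : (C (lam (n + 1)) * P n).natDegree <
        ((X - C (b (n + 1))) * P (n + 1)).natDegree := by
      rw [hd]
      exact lt_of_le_of_lt (natDegree_C_mul_le _ _) (by omega)
    rw [h n]
    exact ⟨hm.sub_of_left (degree_lt_degree hlt),
      (natDegree_sub_eq_left_of_natDegree_lt hlt).trans hd⟩

theorem laguerreP_monic_and_natDegree (a : ℝ) (n : ℕ) :
    (laguerreP a n).Monic ∧ (laguerreP a n).natDegree = n :=
  (laguerreP_recurrence a).monic_and_natDegree (laguerreP_zero a) (c := 0)
    (by simp [laguerreP_one]) n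

theorem laguerreP_monic (a : ℝ) (n : ℕ) : (laguerreP a n).Monic :=
  (laguerreP_monic_and_natDegree a n).1

theorem laguerreP_degree (a : ℝ) (n : ℕ) : (laguerreP a n).degree = n := by
  rw [degree_eq_natDegree (laguerreP_monic a n).ne_zero, (laguerreP_monic_and_natDegree a n).2]

end Laguerre

/-! ### Derangements: deleting the largest value. -/

section InsertMax

/-- The permutation of `Fin (n + 1)` that takes its largest value at `p` and is order isomorphic
to `τ` elsewhere. -/
def insertMax {n : ℕ} (p : Fin (n + 1)) (τ : Equiv.Perm (Fin n)) : Equiv.Perm (Fin (n + 1)) :=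
  ((finSuccEquiv' p).trans (Equiv.optionCongr τ)).trans (finSuccEquiv' (Fin.last n)).symm

theorem insertMax_self {n : ℕ} (p : Fin (n + 1)) (τ : Equiv.Perm (Fin n)) :
    insertMax p τ p = Fin.last n := by
  simp [insertMax]

theorem insertMax_succAbove {n : ℕ} (p : Fin (n + 1)) (τ : Equiv.Perm (Fin n)) (i : Fin n) :
    insertMax p τ (p.succAbove i) = (τ i).castSucc := by
  simp [insertMax]

theorem insertMax_bijective (n : ℕ) :
    Function.Bijective fun x : Fin (n + 1) × Equiv.Perm (Fin n) => insertMax x.1 x.2 := by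
  rw [Fintype.bijective_iff_injective_and_card]
  refine ⟨?_, by simp [Fintype.card_perm, Nat.factorial_succ]⟩
  rintro ⟨p, τ⟩ ⟨q, ρ⟩ h
  simp only at h
  have hpq : p = q := by
    apply (insertMax q ρ).injective
    rw [insertMax_self, ← h, insertMax_self]
  subst hpq
  have : τ = ρ := by
    ext1 i
    have := congrArg (fun σ : Equiv.Perm (Fin (n + 1)) => σ (p.succAbove i)) h
    simpa [insertMax_succAbove] using this
  rw [this]

/-- The largest value never obstructs a minimum to its left, and is itself one only when nothing
follows it. -/
theorem rlm_insertMax {n : ℕ} (p : Fin (n + 1)) (τ : Equiv.Perm (Fin n)) :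
    rlm (insertMax p τ) = rlm τ + if p = Fin.last n then 1 else 0 := by
  have hset : {i : Fin (n + 1) | ∀ j, i < j → insertMax p τ i < insertMax p τ j} =
      p.succAbove '' {i | ∀ j, i < j → τ i < τ j} ∪
        (if p = Fin.last n then {p} else ∅) := by
    ext i
    simp only [Set.mem_union, Set.mem_image, Set.mem_ofPred_eq]
    rcases Fin.eq_self_or_eq_succAbove p i with rfl | ⟨k, rfl⟩
    · have h1 : ¬ ∃ x, (∀ j, x < j → τ x < τ j) ∧ i.succAbove x = i := by
        rintro ⟨x, -, hx⟩
        exact Fin.succAbove_ne _ _ hx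
      simp only [h1, false_or, insertMax_self]
      split_ifs with hp
      · simp only [Set.mem_singleton_iff, iff_true]
        intro j hj
        exact absurd hj (by rw [hp]; exact not_lt.2 (Fin.le_last j))
      · simp only [Set.mem_empty_iff_false, iff_false, not_forall]
        exact ⟨Fin.last n, lt_of_le_of_ne (Fin.le_last i) hp, not_lt.2 (Fin.le_last _)⟩
    · have h2 : p.succAbove k ∉ (if p = Fin.last n then {p} else ∅ : Set (Fin (n + 1))) := by
        split_ifs <;> simp [Fin.succAbove_ne]
      simp only [h2, or_false, Fin.succAbove_right_inj, exists_eq_right]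
      rw [Fin.forall_iff_succAbove p]
      simp only [insertMax_self, insertMax_succAbove, Fin.castSucc_lt_castSucc_iff,
        Fin.succAbove_lt_succAbove_iff, Fin.castSucc_lt_last, implies_true, true_and]
  unfold rlm
  rw [hset, Set.ncard_union_eq _ (Set.toFinite _) (Set.toFinite _),
    Set.ncard_image_of_injective _ Fin.succAbove_right_injective]
  · split_ifs <;> simp
  · split_ifs <;> simp [Fin.succAbove_ne]

/-- The sum of `a ^ rlm σ` over the permutations `σ` with `σ i ≠ f i` for all `i`. -/
noncomputable def avoidSum (a : ℝ) {m : ℕ} (f : Fin m → ℕ) : ℝ :=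
  ∑ σ : Equiv.Perm (Fin m), if ∀ i, (σ i : ℕ) ≠ f i then a ^ rlm σ else 0

theorem avoidSum_zero (a : ℝ) (f : Fin 0 → ℕ) : avoidSum a f = 1 := by
  simp [avoidSum, rlm]

theorem avoidSum_succ (a : ℝ) {m : ℕ} (f : Fin (m + 1) → ℕ) :
    avoidSum a f = ∑ p, if f p ≠ m then
      (if p = Fin.last m then a else 1) * avoidSum a (f ∘ p.succAbove) else 0 := by
  unfold avoidSum
  rw [← (insertMax_bijective m).sum_comp, Fintype.sum_prod_type]
  refine Finset.sum_congr rfl fun p _ => ?_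
  simp only [Fin.forall_iff_succAbove p, insertMax_self, insertMax_succAbove, Fin.val_last,
    Fin.val_castSucc, rlm_insertMax, Function.comp_apply]
  by_cases hp : f p = m
  · simp [hp]
  · simp only [ne_eq, hp, Ne.symm hp, not_false_eq_true, true_and, if_true, Finset.mul_sum]
    refine Finset.sum_congr rfl fun τ _ => ?_
    split_ifs <;> simp [pow_succ, mul_comm]

theorem derangementPoly_eval (a : ℝ) (n : ℕ) :
    (derangementPoly n).eval a = avoidSum a (fun i : Fin n => (i : ℕ)) := by
  classical
  simp only [derangementPoly, Polynomial.eval_finsetSum, Polynomial.eval_pow,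
    Polynomial.eval_X, avoidSum, ← Finset.sum_filter]
  refine Finset.sum_congr (Finset.filter_congr fun σ _ => ?_) fun _ _ => rfl
  simp [derangements, Fin.ext_iff]

/-! ### Forbidden values as finite sets. -/

/-- The sum `avoidSum` for an increasing sequence `f` as a function of the range of `f`, computed
by removing the largest value of the permutation. -/
noncomputable def boardSum (a : ℝ) : ℕ → Finset ℕ → ℝ
  | 0, _ => 1
  | n + 1, S => ∑ i ∈ S.erase n, (if ∀ j ∈ S, j ≤ i then a else 1) * boardSum a n (S.erase i)

/-- As `f` increases, each position can be named by its forbidden value, the last position being the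
maximum. -/
theorem avoidSum_eq_boardSum (a : ℝ) {m : ℕ} (f : Fin m → ℕ) (hf : StrictMono f) :
    avoidSum a f = boardSum a m (Finset.univ.image f) := by
  induction m with
  | zero => rw [avoidSum_zero, boardSum]
  | succ m ih =>
    rw [avoidSum_succ, boardSum, ← Finset.filter_ne', Finset.sum_filter,
      Finset.sum_image hf.injective.injOn]
    refine Finset.sum_congr rfl fun p _ => ?_
    have h1 : (∀ j ∈ Finset.univ.image f, j ≤ f p) ↔ p = Fin.last m := by
      simp only [Finset.mem_image, Finset.mem_univ, true_and, forall_exists_index,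
        forall_apply_eq_imp_iff, hf.le_iff_le]
      exact ⟨fun h => le_antisymm (Fin.le_last p) (h _), fun h j => h ▸ Fin.le_last j⟩
    have h2 : (Finset.univ.image f).erase (f p) = Finset.univ.image (f ∘ p.succAbove) := by
      ext x
      simp only [Finset.mem_erase, Finset.mem_image, Finset.mem_univ, true_and,
        Function.comp_apply]
      constructor
      · rintro ⟨hx, i, rfl⟩
        rcases Fin.eq_self_or_eq_succAbove p i with rfl | ⟨k, rfl⟩
        · exact absurd rfl hx
        · exact ⟨k, rfl⟩
      · rintro ⟨k, rfl⟩
        exact ⟨fun h => Fin.succAbove_ne _ _ (hf.injective h), _, rfl⟩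
    rw [ih _ (hf.comp (Fin.strictMono_succAbove p)), h2]
    simp only [h1]

/-- The value of `boardSum a n S` in terms of the elements `T` of `S` below `n` and the number `h`
of the other elements. -/
noncomputable def openSum (a : ℝ) : ℕ → Finset ℕ → ℕ → ℝ
  | 0, _, _ => 1
  | n + 1, T, h =>
    (if h = 0 then 0 else (a + h - 1) *
      openSum a n (T.erase n) (h - 1 + if n ∈ T then 1 else 0)) +
    ∑ t ∈ T.erase n, openSum a n ((T.erase n).erase t) (h + if n ∈ T then 1 else 0)

theorem sum_ite_max (a : ℝ) (H : Finset ℕ) :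
    ∑ i ∈ H, (if ∀ j ∈ H, j ≤ i then a else 1) =
      if H.card = 0 then 0 else a + H.card - 1 := by
  rcases H.eq_empty_or_nonempty with rfl | hH
  · simp
  · have h1 : ∀ i ∈ H.erase (H.max' hH), (if ∀ j ∈ H, j ≤ i then a else 1) = 1 := by
      intro i hi
      rw [if_neg]
      intro h
      exact (Finset.ne_of_mem_erase hi)
        (le_antisymm (Finset.le_max' _ _ (Finset.mem_of_mem_erase hi)) (h _ (H.max'_mem hH)))
    rw [← Finset.add_sum_erase _ _ (H.max'_mem hH), Finset.sum_congr rfl h1,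
      if_pos fun j hj => H.le_max' j hj, if_neg hH.card_pos.ne']
    simp only [Finset.sum_const, nsmul_eq_mul, mul_one, Finset.card_erase_of_mem (H.max'_mem hH)]
    rw [Nat.cast_sub hH.card_pos]
    push_cast
    ring

/-- Elements of `S` that are at least `n` forbid nothing any more, so only their number matters. One
of them is the maximum of `S`, so together they weigh a+h-1. -/
theorem boardSum_eq_openSum (a : ℝ) (n : ℕ) (S : Finset ℕ) (hS : S.card = n) :
    boardSum a n S = openSum a n (S.filter (· < n)) (S.filter (n ≤ ·)).card := by
  induction n generalizing S with
  | zero => rw [boardSum, openSum]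
  | succ n ih =>
    rw [boardSum, openSum]
    set T := S.filter (· < n + 1) with hT
    set H := S.filter (n + 1 ≤ ·) with hH
    have hnT : n ∈ T ↔ n ∈ S := by simp [hT]
    have hsplit : S.erase n = H ∪ T.erase n := by
      ext x; simp only [hT, hH, Finset.mem_erase, Finset.mem_union, Finset.mem_filter]; grind
    have hdisj : Disjoint H (T.erase n) := by
      rw [Finset.disjoint_left]
      intro x; simp only [hT, hH, Finset.mem_erase, Finset.mem_filter]; omega
    rw [hsplit, Finset.sum_union hdisj]
    congr 1
    · have key : ∀ i ∈ H, (if ∀ j ∈ S, j ≤ i then a else 1) * boardSum a n (S.erase i) =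
          (if ∀ j ∈ H, j ≤ i then a else 1) *
            openSum a n (T.erase n) (H.card - 1 + if n ∈ T then 1 else 0) := by
        intro i hi
        have hi' := hi
        simp only [hH, Finset.mem_filter] at hi'
        have c1 : (∀ j ∈ S, j ≤ i) ↔ ∀ j ∈ H, j ≤ i := by
          refine ⟨fun h j hj => h j (Finset.mem_of_mem_filter _ hj), fun h j hj => ?_⟩
          by_cases hjn : n + 1 ≤ j
          · exact h j (Finset.mem_filter.2 ⟨hj, hjn⟩)
          · omega
        have c2 : (S.erase i).filter (· < n) = T.erase n := by
          ext x; simp only [hT, Finset.mem_erase, Finset.mem_filter]; grind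
        have c3 : ((S.erase i).filter (n ≤ ·)).card = H.card - 1 + if n ∈ T then 1 else 0 := by
          simp only [hnT]
          rw [← Finset.card_erase_of_mem hi]
          split_ifs with hn
          · rw [← Finset.card_insert_of_notMem (a := n) (s := H.erase i) (by simp [hH])]
            congr 1
            ext x; simp only [hH, Finset.mem_erase, Finset.mem_filter, Finset.mem_insert]; grind
          · rw [add_zero]
            congr 1
            ext x; simp only [hH, Finset.mem_erase, Finset.mem_filter]; grind
        rw [ih _ (by rw [Finset.card_erase_of_mem hi'.1, hS]; rfl), c2, c3]
        simp only [c1]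
      rw [Finset.sum_congr rfl key, ← Finset.sum_mul, sum_ite_max]
      split_ifs <;> simp
    · refine Finset.sum_congr rfl fun i hi => ?_
      have hi' := hi
      simp only [hT, Finset.mem_erase, Finset.mem_filter] at hi'
      -- `S` has n+1 elements, too many to lie below `n`; so `i` is not its maximum and has weight
      -- 1.
      have c1 : ¬ ∀ j ∈ S, j ≤ i := by
        intro h
        have : S ⊆ Finset.range n := fun j hj => by
          have := h j hj
          simp; omega
        have := Finset.card_le_card this
        simp [hS] at this
      have c2 : (S.erase i).filter (· < n) = (T.erase n).erase i := by
        ext x; simp only [hT, Finset.mem_erase, Finset.mem_filter]; grind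
      have c3 : ((S.erase i).filter (n ≤ ·)).card = H.card + if n ∈ T then 1 else 0 := by
        simp only [hnT]
        split_ifs with hn
        · rw [← Finset.card_insert_of_notMem (a := n) (s := H) (by simp [hH])]
          congr 1
          ext x; simp only [hH, Finset.mem_erase, Finset.mem_filter, Finset.mem_insert]; grind
        · rw [add_zero]
          congr 1
          ext x; simp only [hH, Finset.mem_erase, Finset.mem_filter]; grind
      rw [ih _ (by rw [Finset.card_erase_of_mem hi'.2.1, hS]; rfl), c2, c3, if_neg c1, one_mul]

/-! ### The recurrence for history sums. -/

/-- The sum of `openSum a n T h` over the subsets `T` of `Finset.range n` of size `n - h`. -/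
noncomputable def historySum (a : ℝ) (n h : ℕ) : ℝ :=
  ∑ T ∈ (Finset.range n).powerset, if T.card + h = n then openSum a n T h else 0

theorem derangementPoly_eval_eq_historySum (a : ℝ) (n : ℕ) :
    (derangementPoly n).eval a = historySum a n 0 := by
  rw [derangementPoly_eval, avoidSum_eq_boardSum a _ Fin.val_strictMono]
  have hr : Finset.univ.image (fun i : Fin n => (i : ℕ)) = Finset.range n := by
    ext x
    simp only [Finset.mem_image, Finset.mem_univ, true_and, Finset.mem_range]
    exact ⟨fun ⟨i, hi⟩ => hi ▸ i.2, fun hx => ⟨⟨x, hx⟩, rfl⟩⟩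
  rw [hr, boardSum_eq_openSum a n _ (Finset.card_range n), historySum,
    Finset.sum_eq_single (Finset.range n)]
  · have h1 : (Finset.range n).filter (· < n) = Finset.range n := by
      ext; simp
    have h2 : (Finset.range n).filter (n ≤ ·) = ∅ := by
      ext; simp
    simp [h1, h2]
  · intro T hT hne
    rw [if_neg]
    intro hc
    exact hne (Finset.eq_of_subset_of_card_le (Finset.mem_powerset.1 hT) (by simp; omega))
  · simp

/-- Double counting: a set with h elements of `R` missing arises by erasure in h ways, one for each
missing element. -/
theorem sum_powerset_sum_erase (g : Finset ℕ → ℝ) (R : Finset ℕ) (h : ℕ) :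
    ∑ T ∈ R.powerset, (if T.card + h = R.card + 1 then ∑ t ∈ T, g (T.erase t) else 0) =
      h * ∑ T ∈ R.powerset, if T.card + h = R.card then g T else 0 := by
  have hL : ∀ T ∈ R.powerset, (if T.card + h = R.card + 1 then ∑ t ∈ T, g (T.erase t) else 0) =
      ∑ t ∈ R, if t ∈ T ∧ T.card + h = R.card + 1 then g (T.erase t) else 0 := by
    intro T hT
    split_ifs with hc
    · simp only [hc, and_true]
      rw [← Finset.sum_filter, Finset.filter_mem_eq_inter,
        Finset.inter_eq_right.2 (Finset.mem_powerset.1 hT)]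
    · simp [hc]
  have hR : ∀ T ∈ R.powerset, (h * if T.card + h = R.card then g T else 0 : ℝ) =
      ∑ t ∈ R, if t ∉ T ∧ T.card + h = R.card then g T else 0 := by
    intro T hT
    split_ifs with hc
    · simp only [hc, and_true]
      rw [← Finset.sum_filter, Finset.sum_const, nsmul_eq_mul, ← Finset.sdiff_eq_filter,
        Finset.card_sdiff_of_subset (Finset.mem_powerset.1 hT)]
      congr 2
      omega
    · simp [hc]
  rw [Finset.mul_sum, Finset.sum_congr rfl hL, Finset.sum_congr rfl hR, Finset.sum_comm,
    Finset.sum_comm (s := R.powerset)]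
  refine Finset.sum_congr rfl fun t ht => ?_
  rw [← Finset.sum_filter, ← Finset.sum_filter]
  refine Finset.sum_bij' (fun T _ => T.erase t) (fun T _ => insert t T) ?_ ?_ ?_ ?_ ?_
  · intro T hT
    simp only [Finset.mem_filter, Finset.mem_powerset] at hT ⊢
    refine ⟨(Finset.erase_subset _ _).trans hT.1, Finset.notMem_erase _ _, ?_⟩
    have := Finset.card_erase_add_one hT.2.1
    omega
  · intro T hT
    simp only [Finset.mem_filter, Finset.mem_powerset] at hT ⊢
    refine ⟨Finset.insert_subset ht hT.1, Finset.mem_insert_self _ _, ?_⟩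
    rw [Finset.card_insert_of_notMem hT.2.1]
    omega
  · intro T hT
    simp only [Finset.mem_filter, Finset.mem_powerset] at hT
    exact Finset.insert_erase hT.2.1
  · intro T hT
    simp only [Finset.mem_filter, Finset.mem_powerset] at hT
    exact Finset.erase_insert hT.2.1
  · intro T _
    rfl

theorem historySum_zero (a : ℝ) (h : ℕ) : historySum a 0 h = if h = 0 then 1 else 0 := by
  by_cases hh : h = 0 <;> simp [historySum, openSum, hh]

theorem historySum_eq_zero (a : ℝ) {n h : ℕ} (hn : n < h) : historySum a n h = 0 := by
  refine Finset.sum_eq_zero fun T _ => if_neg ?_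
  omega

theorem historySum_succ (a : ℝ) (n h : ℕ) :
    historySum a (n + 1) h =
      (if h = 0 then 0 else (a + h - 1) * historySum a n (h - 1)) +
        (if h = 0 then 0 else (a + 2 * h - 1)) * historySum a n h +
          (h + 1) * historySum a n (h + 1) := by
  -- Subsets without `n` give (a+h-1) H(n,h-1) + h H(n,h); those with `n`, in `e2`, give (a+h-1)
  -- H(n,h) + (h+1) H(n,h+1), where the first term is absent for h = 0.
  have e1 : ∀ T ∈ (Finset.range n).powerset,
      (if T.card + h = n + 1 then openSum a (n + 1) T h else 0) =
        (if h = 0 then 0 else (a + h - 1) *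
          if T.card + (h - 1) = n then openSum a n T (h - 1) else 0) +
        if T.card + h = (Finset.range n).card + 1 then
          ∑ t ∈ T, openSum a n (T.erase t) h else 0 := by
    intro T hT
    have hn : n ∉ T := fun hn => by simpa using Finset.mem_powerset.1 hT hn
    have hc : T.card ≤ n := by simpa using Finset.card_le_card (Finset.mem_powerset.1 hT)
    simp only [openSum, hn, if_false, add_zero, Finset.erase_eq_of_notMem hn, Finset.card_range]
    rcases h with _ | h
    · simp
    · have : T.card + (h + 1) = n + 1 ↔ T.card + (h + 1 - 1) = n := by omega
      simp only [this]
      split_ifs <;> simp_all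
  have e2 : ∀ T ∈ (Finset.range n).powerset,
      (if (insert n T).card + h = n + 1 then openSum a (n + 1) (insert n T) h else 0) =
        (if h = 0 then 0 else (a + h - 1)) * (if T.card + h = n then openSum a n T h else 0) +
        if T.card + (h + 1) = (Finset.range n).card + 1 then
          ∑ t ∈ T, openSum a n (T.erase t) (h + 1) else 0 := by
    intro T hT
    have hn : n ∉ T := fun hn => by simpa using Finset.mem_powerset.1 hT hn
    have h1 : T.card + 1 + h = n + 1 ↔ T.card + h = n := by omega
    have h2 : T.card + (h + 1) = n + 1 ↔ T.card + h = n := by omega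
    simp only [openSum, Finset.mem_insert_self, if_true, Finset.erase_insert hn,
      Finset.card_insert_of_notMem hn, Finset.card_range, h1, h2]
    rcases h with _ | h
    · simp
    · simp only [Nat.add_one_sub_one]
      split_ifs <;> simp_all
  have hd := sum_powerset_sum_erase (fun T => openSum a n T h) (Finset.range n) h
  have hd' := sum_powerset_sum_erase (fun T => openSum a n T (h + 1)) (Finset.range n) (h + 1)
  unfold historySum
  rw [Finset.range_add_one, Finset.sum_powerset_insert Finset.notMem_range_self,
    Finset.sum_congr rfl e1, Finset.sum_congr rfl e2, Finset.sum_add_distrib,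
    Finset.sum_add_distrib, hd, hd', ← Finset.mul_sum]
  simp only [Finset.card_range]
  rcases h with _ | h
  · simp
  · simp only [Nat.add_eq_zero_iff, one_ne_zero, and_false, if_false, ← Finset.mul_sum]
    push_cast
    ring

theorem historySum_self (a : ℝ) (n : ℕ) :
    historySum a n n = ∏ k ∈ Finset.range n, (a + k) := by
  induction n with
  | zero => simp [historySum_zero]
  | succ n ih =>
    rw [historySum_succ, historySum_eq_zero a (Nat.lt_succ_self n),
      historySum_eq_zero a (show n < n + 1 + 1 by omega), Finset.prod_range_succ]
    simp [ih]
    ring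

end InsertMax

/-! ### The moment functional and orthogonality. -/

section Moments

open Polynomial

theorem linearMap_eq_of_degree_eq {V : Type*} [AddCommGroup V] [Module ℝ V] {P : ℕ → ℝ[X]}
    (hm : ∀ n, (P n).Monic) (hd : ∀ n, (P n).degree = n) {F G : ℝ[X] →ₗ[ℝ] V}
    (h : ∀ n, F (P n) = G (P n)) : F = G := by
  let S : Polynomial.Sequence ℝ := ⟨P, hd⟩
  have hs : Submodule.span ℝ (Set.range P) = ⊤ := S.span fun i => by
    change IsUnit (P i).leadingCoeff
    rw [(hm i).leadingCoeff]
    exact isUnit_one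
  exact LinearMap.ext_on_range hs h

/-- The functional `ℒ` with `ℒ(x ^ n) = D_n(a)`. -/
noncomputable abbrev derangementFunctional (a : ℝ) : ℝ[X] →ₗ[ℝ] ℝ :=
  momentFunctional fun n => (derangementPoly n).eval a

/-- Both sides obey the same recurrence in h; `n` stays general because solving for P_{h+2} calls
for x^(n+1) P_{h+1}. -/
theorem derangementFunctional_X_pow_mul (a : ℝ) (n h : ℕ) :
    derangementFunctional a (X ^ n * laguerreP a h) = h.factorial * historySum a n h := by
  induction h using Nat.twoStepInduction generalizing n with
  | zero =>
    simp [laguerreP_zero, momentFunctional_X_pow, derangementPoly_eval_eq_historySum]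
  | one =>
    rw [laguerreP_one, ← pow_succ, momentFunctional_X_pow, derangementPoly_eval_eq_historySum,
      historySum_succ]
    simp
  | more h ih0 ih1 =>
    have e (b l : ℝ) : X ^ n * ((X - C b) * laguerreP a (h + 1) - C l * laguerreP a h) =
        X ^ (n + 1) * laguerreP a (h + 1) - b • (X ^ n * laguerreP a (h + 1)) -
          l • (X ^ n * laguerreP a h) := by
      simp only [smul_eq_C_mul]
      ring
    rw [laguerreP_recurrence a h, e, map_sub, map_sub, map_smul, map_smul, ih0, ih1, ih1,
      historySum_succ]
    simp only [Nat.add_eq_zero_iff, one_ne_zero, and_false, if_false, Nat.add_one_sub_one,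
      smul_eq_mul, Nat.factorial_succ]
    push_cast
    ring

theorem derangementFunctional_mul_eq_zero (a : ℝ) {p : ℝ[X]} {n : ℕ} (hp : p.degree < n) :
    derangementFunctional a (p * laguerreP a n) = 0 := by
  rw [p.as_sum_support_C_mul_X_pow, Finset.sum_mul, map_sum]
  refine Finset.sum_eq_zero fun i hi => ?_
  have hin : i < n := by exact_mod_cast (le_degree_of_mem_supp i hi).trans_lt hp
  rw [mul_assoc, ← smul_eq_C_mul, map_smul, derangementFunctional_X_pow_mul,
    historySum_eq_zero a hin, mul_zero, smul_zero]

theorem derangementFunctional_orthogonal (a : ℝ) {m n : ℕ} (h : m ≠ n) :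
    derangementFunctional a (laguerreP a m * laguerreP a n) = 0 := by
  rcases lt_or_gt_of_ne h with h | h
  · exact derangementFunctional_mul_eq_zero a (by rw [laguerreP_degree]; exact_mod_cast h)
  · rw [mul_comm]
    exact derangementFunctional_mul_eq_zero a (by rw [laguerreP_degree]; exact_mod_cast h)

theorem derangementFunctional_norm (a : ℝ) (n : ℕ) :
    derangementFunctional a (laguerreP a n * laguerreP a n) =
      n.factorial * ∏ k ∈ Finset.range n, (a + k) := by
  -- One factor P_n may be replaced by x^n, the difference being orthogonal to P_n.
  have hlt : (laguerreP a n - X ^ n).degree < (n : WithBot ℕ) := by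
    have := degree_sub_lt_left (p := laguerreP a n) (q := X ^ n)
      (by rw [laguerreP_degree, degree_X_pow]) (laguerreP_monic a n).ne_zero
      (by rw [(laguerreP_monic a n).leadingCoeff, (monic_X_pow n).leadingCoeff])
    rwa [laguerreP_degree] at this
  have h := derangementFunctional_mul_eq_zero a hlt
  rw [sub_mul, map_sub, derangementFunctional_X_pow_mul, historySum_self] at h
  linarith

theorem momentFunctional_orthogonal_iff (a : ℝ) (μ : ℕ → ℝ) :
    (μ 0 = 1 ∧ ∀ m n : ℕ, m ≠ n →
      momentFunctional μ (laguerreP a m * laguerreP a n) = 0) ↔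
    ∀ n : ℕ, μ n = (derangementPoly n).eval a := by
  constructor
  · rintro ⟨h0, h⟩ n
    have key : momentFunctional μ = derangementFunctional a := by
      -- Both functionals send P_0 to 1 and every other P_n = P_0 P_n to 0.
      refine linearMap_eq_of_degree_eq (laguerreP_monic a) (laguerreP_degree a) fun n => ?_
      have hD := derangementFunctional_X_pow_mul a 0 n
      rw [pow_zero, one_mul, historySum_zero] at hD
      rw [hD]
      rcases Nat.eq_zero_or_pos n with rfl | hn
      · have := momentFunctional_X_pow μ 0
        rw [pow_zero] at this
        simp [laguerreP_zero, this, h0]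
      · have := h 0 n hn.ne
        rw [laguerreP_zero, one_mul] at this
        simp [this, hn.ne']
    rw [← momentFunctional_X_pow μ n, key, momentFunctional_X_pow]
  · intro h
    obtain rfl : μ = fun n => (derangementPoly n).eval a := funext h
    refine ⟨?_, fun m n hmn => derangementFunctional_orthogonal a hmn⟩
    simp [derangementPoly_eval_eq_historySum, historySum_zero]

end Moments

theorem mainTheorem4 (a : ℝ) :
    IsCoRecursive (fun n : ℕ => a + 2 * n - 1) (fun n : ℕ => n * (n + a - 1)) (1 - a)
      (fun n => (laguerre (a - 1) n).comp (Polynomial.X + 1)) (laguerreP a) ∧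
    (∀ n : ℕ, (laguerreP a n).Monic ∧ (laguerreP a n).degree = n) ∧
    (∀ μ : ℕ → ℝ,
      (μ 0 = 1 ∧ ∀ m n : ℕ, m ≠ n →
        momentFunctional μ (laguerreP a m * laguerreP a n) = 0) ↔
      ∀ n : ℕ, μ n = (derangementPoly n).eval a) ∧
    ((∀ k : ℕ, a ≠ -(k : ℝ)) →
      IsOrthogonalSeq (momentFunctional fun n => (derangementPoly n).eval a) (laguerreP a)) ∧
    (0 < a → ∀ n : ℕ,
      0 < momentFunctional (fun n => (derangementPoly n).eval a)
        (laguerreP a n * laguerreP a n)) :=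
  ⟨laguerreP_isCoRecursive a, fun n => ⟨laguerreP_monic a n, laguerreP_degree a n⟩,
    momentFunctional_orthogonal_iff a,
    fun ha => ⟨laguerreP_degree a, fun _ _ => derangementFunctional_orthogonal a, fun n => by
      rw [derangementFunctional_norm]
      refine mul_ne_zero (Nat.cast_ne_zero.2 n.factorial_ne_zero)
        (Finset.prod_ne_zero_iff.2 fun k _ hk => ha k (eq_neg_of_add_eq_zero_left hk))⟩,
    fun ha n => by
      rw [derangementFunctional_norm]
      exact mul_pos (Nat.cast_pos.2 n.factorial_pos) (Finset.prod_pos fun k _ => by positivity)⟩
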